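/- Let $(\mathcal C,\otimes,1)$ be a small semicartesian monoidal category (monoidal, with $1$ terminal), and let $\pi_1:A\otimes B\to A$, $\pi_2:A\otimes B\to B$ be the canonical projections. The pseudo-pullback $A\,{}_{f}\!\otimes_{g}B$ of $f:A\to X$, $g:B\to X$ is the equalizer of $f\circ\pi_1,\ g\circ\pi_2:A\otimes B\rightrightarrows X$, with projections $p_1,p_2$ to $A$, $B$. Assume that $\mathcal C$ has all pseudo-pullbacks. A Grothendieck prelopology $L$ assigns to each object $U$ a set $L(U)$ of (small) indexed families $\{f_i:U_i\to U\}_{i\in I}$, the covers of $U$, such that, up to bijections of index sets: 1. $\{f\}\in L(U)$ for every isomorphism $f:V\to U$; 2. if $\{f_i:U_i\to U\}_{i\in I}\in L(U)$ and $\{g_{ij}:V_{ij}\to U_i\}_{j\in J_i}\in L(U_i)$ for all $i$, then $\{f_i\circ g_{ij}\}_{i\in I,\,j\in J_i}\in L(U)$; 3. if $\{f_i\}_{i\in I}\in L(U)$, then $\{f_i\otimes \mathrm{id}_V\}_{i\in I}\in L(U\otimes V)$ and $\{\mathrm{id}_V\otimes f_i\}_{i\in I}\in L(V\otimes U)$ for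 every object $V$; 4. if $\{f_i\}_{i\in I}\in L(U)$ and $g:V\to U$, then the induced families $\{U_i\,{}_{f_i}\!\otimes_{g}V\to U\,{}_{\mathrm{id}_U}\!\otimes_{g}V\}_{i\in I}$ and $\{V\,{}_{g}\!\otimes_{f_i}U_i\to V\,{}_{g}\!\otimes_{\mathrm{id}_U}U\}_{i\in I}$ are covers. Let $\mathrm{PSh}(\mathcal C)=[\mathcal C^{op},\mathbf{Set}]$, let $y$ be the Yoneda embedding and $\star$ the Day convolution, for which $\mathrm{PSh}(\mathcal C)$ is again semicartesian. For a cover $\{f_i:U_i\to U\}_{i\in I}$ let $S(\{U_i\})$ be the coequalizer in $\mathrm{PSh}(\mathcal C)$ of the two arrows $$\coprod_{i,j} y(U_i)\,{}_{y(f_i)}\!\star_{y(f_j)}y(U_j)\ \rightrightarrows\ \coprod_i y(U_i)$$ given by the projections of the pseudo-pullbacks, and let $S(\{U_i\})\to y(U)$ be the canonical map induced by the $y(f_i)$. A presheaf $P$ is a sheaf if $\mathrm{Hom}(-,P)$ sends the canonical maps of all covers to isomorphisms; $\mathrm{Sh}(\mathcal C,L)\subseteq\mathrm{PSh}(\mathcal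 C)$ is the full subcategory of sheaves. An object $K$ is orthogonal to $m:A\to A'$ if every $f:A\to K$ factors as $f=f'\circ m$ for a unique $f':A'\to K$. For a regular cardinal $\lambda$, an object $G$ is $\lambda$-presentable if $\mathrm{Hom}(G,-)$ preserves $\lambda$-filtered colimits. Then: (a) The canonical maps $S(\{U_i\})\to y(U)$ of all covers form a set $\mathcal M$ of morphisms of $\mathrm{PSh}(\mathcal C)$, and $\mathrm{Sh}(\mathcal C,L)=\mathcal M^{\perp}$, the class of all presheaves orthogonal to every morphism in $\mathcal M$. (b) The inclusion $\mathrm{Sh}(\mathcal C,L)\to\mathrm{PSh}(\mathcal C)$ has a left adjoint $a$ (sheafification), and $a$ preserves colimits. (c) For every sufficiently large regular cardinal $\lambda$, all domains and codomains of the morphisms in $\mathcal M$ are $\lambda$-presentable (so $\mathrm{Sh}(\mathcal C,L)$ is a $\lambda$-orthogonality class), and $\mathrm{Sh}(\mathcal C,L)$ is locally $\lambda$-presentable: it is cocomplete and has a set of strong generators, each of which is $\lambda$-presentable. -/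

import Mathlib

open CategoryTheory MonoidalCategory SemiCartesianMonoidalCategory Limits Opposite
open scoped MonoidalCategory.DayFunctor

universe w₁ w₂ u v w

noncomputable section

namespace Prelopology

/-! ### Pseudo-pullbacks in a semicartesian monoidal category -/

section PseudoPullback

variable {D : Type u} [Category.{v} D] [SemiCartesianMonoidalCategory D]

/-- A semicartesian monoidal category has pseudo-pullbacks if for all `f : A ⟶ X` and
`g : B ⟶ X` the parallel pair `π₁ ≫ f, π₂ ≫ g : A ⊗ B ⇉ X` has an equalizer. -/
class HasPseudoPullbacks (D : Type u) [Category.{v} D] [SemiCartesianMonoidalCategory D] :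
    Prop where
  hasEqualizer {A B X : D} (f : A ⟶ X) (g : B ⟶ X) :
    HasEqualizer (fst A B ≫ f) (snd A B ≫ g)

attribute [instance] HasPseudoPullbacks.hasEqualizer

instance [HasEqualizers D] : HasPseudoPullbacks D where
  hasEqualizer _ _ := inferInstance

lemma tensorHom_comp_fst {A B A' B' : D} (a : A ⟶ A') (b : B ⟶ B') :
    (a ⊗ₘ b) ≫ fst A' B' = fst A B ≫ a := by
  rw [fst_def, fst_def, MonoidalCategory.tensorHom_def', Category.assoc, ← whisker_exchange_assoc,
    ← MonoidalCategory.whiskerLeft_comp_assoc, Category.assoc, rightUnitor_naturality]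
  rw [isTerminalTensorUnit.hom_ext (b ≫ isTerminalTensorUnit.from B')
    (isTerminalTensorUnit.from B)]

lemma tensorHom_comp_snd {A B A' B' : D} (a : A ⟶ A') (b : B ⟶ B') :
    (a ⊗ₘ b) ≫ snd A' B' = snd A B ≫ b := by
  rw [snd_def, snd_def, MonoidalCategory.tensorHom_def, Category.assoc, whisker_exchange_assoc,
    ← comp_whiskerRight_assoc, Category.assoc, leftUnitor_naturality]
  rw [isTerminalTensorUnit.hom_ext (a ≫ isTerminalTensorUnit.from A')
    (isTerminalTensorUnit.from A)]

variable [HasPseudoPullbacks D]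

/-- The pseudo-pullback of `f : A ⟶ X` and `g : B ⟶ X`. -/
def pseudoPullback {A B X : D} (f : A ⟶ X) (g : B ⟶ X) : D :=
  equalizer (fst A B ≫ f) (snd A B ≫ g)

namespace pseudoPullback

variable {A B X : D} (f : A ⟶ X) (g : B ⟶ X)

/-- The equalizer arrow of the pseudo-pullback. -/
def ι : pseudoPullback f g ⟶ A ⊗ B :=
  equalizer.ι (fst A B ≫ f) (snd A B ≫ g)

/-- The first projection of the pseudo-pullback. -/
def p₁ : pseudoPullback f g ⟶ A := ι f g ≫ fst A B

/-- The second projection of the pseudo-pullback. -/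
def p₂ : pseudoPullback f g ⟶ B := ι f g ≫ snd A B

lemma condition : p₁ f g ≫ f = p₂ f g ≫ g :=
  (Category.assoc _ _ _).trans
    ((equalizer.condition (fst A B ≫ f) (snd A B ≫ g)).trans (Category.assoc _ _ _).symm)

/-- The arrow between pseudo-pullbacks that is induced by `a ⊗ b`. -/
def map {A' B' : D} {f : A ⟶ X} {g : B ⟶ X} {f' : A' ⟶ X} {g' : B' ⟶ X}
    (a : A ⟶ A') (b : B ⟶ B') (ha : a ≫ f' = f) (hb : b ≫ g' = g) :
    pseudoPullback f g ⟶ pseudoPullback f' g' :=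
  equalizer.lift (ι f g ≫ (a ⊗ₘ b)) (by
    have h := condition f g
    subst ha hb
    simp only [p₁, p₂, Category.assoc] at h
    rw [Category.assoc, Category.assoc, ← Category.assoc (a ⊗ₘ b),
      ← Category.assoc (a ⊗ₘ b), tensorHom_comp_fst, tensorHom_comp_snd]
    simpa only [Category.assoc] using h)

lemma map_ι {A' B' : D} {f : A ⟶ X} {g : B ⟶ X} {f' : A' ⟶ X} {g' : B' ⟶ X}
    (a : A ⟶ A') (b : B ⟶ B') (ha : a ≫ f' = f) (hb : b ≫ g' = g) :
    map a b ha hb ≫ ι f' g' = ι f g ≫ (a ⊗ₘ b) :=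
  equalizer.lift_ι _ _

end pseudoPullback

end PseudoPullback

/-! ### Families of morphisms with a common codomain -/

section Families

variable {C : Type u} [SmallCategory C]

/-- A family `{fᵢ : Uᵢ ⟶ U}` of morphisms indexed by a (small) set. -/
structure Family (U : C) where
  /-- the index set -/
  I : Type u
  /-- the domains -/
  obj : I → C
  /-- the morphisms -/
  map : ∀ i, obj i ⟶ U

namespace Family

/-- The singleton family `{f : V ⟶ U}`. -/
def singleton {U V : C} (f : V ⟶ U) : Family U where
  I := PUnit
  obj _ := V
  map _ := f

/-- The composite family `{V_{ij} ⟶ U_i ⟶ U}`, indexed by all pairs `(i, j)`. -/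
def comp {U : C} (F : Family U) (G : ∀ i, Family (F.obj i)) : Family U where
  I := Σ i, (G i).I
  obj x := (G x.1).obj x.2
  map x := (G x.1).map x.2 ≫ F.map x.1

/-- The same family, indexed along a bijection of index sets. -/
def reindex {U : C} (F : Family U) {K : Type u} (e : K ≃ F.I) : Family U where
  I := K
  obj k := F.obj (e k)
  map k := F.map (e k)

variable [SemiCartesianMonoidalCategory C]

/-- The family `{fᵢ ⊗ id_V : Uᵢ ⊗ V ⟶ U ⊗ V}`. -/
def tensorRight {U : C} (F : Family U) (V : C) : Family (U ⊗ V) where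
  I := F.I
  obj i := F.obj i ⊗ V
  map i := F.map i ▷ V

/-- The family `{id_V ⊗ fᵢ : V ⊗ Uᵢ ⟶ V ⊗ U}`. -/
def tensorLeft {U : C} (F : Family U) (V : C) : Family (V ⊗ U) where
  I := F.I
  obj i := V ⊗ F.obj i
  map i := V ◁ F.map i

variable [HasPseudoPullbacks C]

/-- The family of the arrows from the pseudo-pullback of `fᵢ` and `g` to the pseudo-pullback of
`id_U` and `g`. -/
def pullRight {U : C} (F : Family U) {V : C} (g : V ⟶ U) :
    Family (pseudoPullback (𝟙 U) g) where
  I := F.I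
  obj i := pseudoPullback (F.map i) g
  map i := pseudoPullback.map (F.map i) (𝟙 V) (by simp) (by simp)

/-- The family of the arrows from the pseudo-pullback of `g` and `fᵢ` to the pseudo-pullback of
`g` and `id_U`. -/
def pullLeft {U : C} (F : Family U) {V : C} (g : V ⟶ U) :
    Family (pseudoPullback g (𝟙 U)) where
  I := F.I
  obj i := pseudoPullback g (F.map i)
  map i := pseudoPullback.map (𝟙 V) (F.map i) (by simp) (by simp)

end Family

end Families

/-! ### Grothendieck prelopologies -/

/-- `F` belongs to the collection `L` of families up to the choice of the index set. -/
def MemUpToReindexing {C : Type u} [SmallCategory C] {U : C} (L : Set (Family U))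
    (F : Family U) : Prop :=
  ∃ (K : Type u) (e : K ≃ F.I), F.reindex e ∈ L

/-- A Grothendieck prelopology on `C`. The families in `L U` form a (small) set. As no set of
indexed families can contain a given family with all possible index sets, the closure axioms
are understood up to a bijection of index sets. -/
structure GrothendieckPrelopology (C : Type u) [SmallCategory C]
    [SemiCartesianMonoidalCategory C] [HasPseudoPullbacks C] where
  /-- the covers of `U` -/
  covers (U : C) : Set (Family U)
  small_covers (U : C) : Small.{u} (covers U)
  iso {U V : C} (f : V ⟶ U) [IsIso f] : MemUpToReindexing (covers U) (.singleton f)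
  comp {U : C} (F : Family U) (G : ∀ i, Family (F.obj i)) (hF : F ∈ covers U)
    (hG : ∀ i, G i ∈ covers (F.obj i)) : MemUpToReindexing (covers U) (F.comp G)
  tensorRight {U : C} (F : Family U) (hF : F ∈ covers U) (V : C) :
    MemUpToReindexing (covers (U ⊗ V)) (F.tensorRight V)
  tensorLeft {U : C} (F : Family U) (hF : F ∈ covers U) (V : C) :
    MemUpToReindexing (covers (V ⊗ U)) (F.tensorLeft V)
  pullRight {U : C} (F : Family U) (hF : F ∈ covers U) {V : C} (g : V ⟶ U) :
    MemUpToReindexing (covers (pseudoPullback (𝟙 U) g)) (F.pullRight g)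
  pullLeft {U : C} (F : Family U) (hF : F ∈ covers U) {V : C} (g : V ⟶ U) :
    MemUpToReindexing (covers (pseudoPullback g (𝟙 U))) (F.pullLeft g)

attribute [instance] GrothendieckPrelopology.small_covers

/-! ### Presheaves and Day convolution -/

/-- The category of presheaves of sets. -/
abbrev PSh (C : Type u) [SmallCategory C] : Type (u + 1) := Cᵒᵖ ⥤ Type u

section Day

variable (C : Type u) [SmallCategory C]

/-- The category of presheaves of sets (up to a one-field wrapper), which carries the
monoidal structure given by Day convolution. -/
abbrev DayPSh [MonoidalCategory C] : Type (u + 1) := Cᵒᵖ ⊛⥤ Type u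

instance [MonoidalCategory C] : HasEqualizers (DayPSh C) :=
  Adjunction.hasLimitsOfShape_of_equivalence (DayFunctor.equiv Cᵒᵖ (Type u)).functor

variable {C}

/-- The Yoneda embedding into the presheaves with Day convolution. -/
def yDay [MonoidalCategory C] : C ⥤ DayPSh C :=
  yoneda ⋙ (DayFunctor.equiv Cᵒᵖ (Type u)).inverse

variable (C) [SemiCartesianMonoidalCategory C]

/-- The presheaf represented by the unit object is a terminal presheaf. -/
def yDayUnitIsTerminal : IsTerminal ((yDay (C := C)).obj (𝟙_ C)) :=
  IsTerminal.ofUniqueHom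
    (fun F ↦ .mk
      { app := fun W ↦ TypeCat.ofHom fun _ ↦ toUnit W.unop
        naturality := fun _ _ _ ↦ by ext; exact toUnit_unique _ _ })
    (fun F m ↦ by
      ext W x
      exact toUnit_unique _ _)

/-- The unit of Day convolution is the presheaf represented by the unit object. -/
def dayUnitIso : 𝟙_ (DayPSh C) ≅ (yDay (C := C)).obj (𝟙_ C) where
  hom := (yDayUnitIsTerminal C).from _
  inv := .mk (yonedaEquiv.symm (DayFunctor.ν Cᵒᵖ (Type u) PUnit.unit))
  hom_inv_id := by
    apply DayFunctor.unit_hom_ext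
    ext x
    let t : (𝟙_ (DayPSh C)).functor.obj (op (𝟙_ C)) := DayFunctor.ν Cᵒᵖ (Type u) PUnit.unit
    have key : ∀ f : 𝟙_ C ⟶ 𝟙_ C, (𝟙_ (DayPSh C)).functor.map f.op t = t := fun f ↦ by
      rw [toUnit_unique f (𝟙 _)]
      simp
    exact key _
  inv_hom_id := (yDayUnitIsTerminal C).hom_ext _ _

/-- The presheaves on a semicartesian monoidal category are semicartesian for Day convolution. -/
instance : SemiCartesianMonoidalCategory (DayPSh C) where
  toMonoidalCategory := inferInstance
  isTerminalTensorUnit := (yDayUnitIsTerminal C).ofIso (dayUnitIso C).symm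
  fst F G := F ◁ ((yDayUnitIsTerminal C).ofIso (dayUnitIso C).symm).from G ≫ (ρ_ F).hom
  snd F G := ((yDayUnitIsTerminal C).ofIso (dayUnitIso C).symm).from F ▷ G ≫ (λ_ G).hom

end Day

/-! ### Sieves, canonical maps and sheaves -/

section Sheaves

variable {C : Type u} [SmallCategory C] [SemiCartesianMonoidalCategory C]

namespace Family

variable {U : C} (F : Family U)

/-- The pseudo-pullback of `y(fᵢ)` and `y(fⱼ)` with respect to Day convolution. -/
def overlap (x : F.I × F.I) : DayPSh C :=
  pseudoPullback (yDay.map (F.map x.1)) (yDay.map (F.map x.2))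

/-- The first projection of the pseudo-pullback of `y(fᵢ)` and `y(fⱼ)`. -/
def proj₁ (x : F.I × F.I) : (F.overlap x).functor ⟶ yoneda.obj (F.obj x.1) :=
  (pseudoPullback.p₁ (yDay.map (F.map x.1)) (yDay.map (F.map x.2))).natTrans

/-- The second projection of the pseudo-pullback of `y(fᵢ)` and `y(fⱼ)`. -/
def proj₂ (x : F.I × F.I) : (F.overlap x).functor ⟶ yoneda.obj (F.obj x.2) :=
  (pseudoPullback.p₂ (yDay.map (F.map x.1)) (yDay.map (F.map x.2))).natTrans

lemma proj_condition (x : F.I × F.I) :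
    F.proj₁ x ≫ yoneda.map (F.map x.1) = F.proj₂ x ≫ yoneda.map (F.map x.2) :=
  congrArg DayFunctor.Hom.natTrans
    (pseudoPullback.condition (yDay.map (F.map x.1)) (yDay.map (F.map x.2)))

/-- The arrow `∐ᵢⱼ y(Uᵢ) ⋆ y(Uⱼ) ⟶ ∐ᵢ y(Uᵢ)` (over pseudo-pullbacks) given by the first
projections. -/
def fstMap : (∐ fun x : F.I × F.I ↦ (F.overlap x).functor) ⟶
    ∐ fun i ↦ yoneda.obj (F.obj i) :=
  Sigma.desc fun x ↦ F.proj₁ x ≫ Sigma.ι (fun i ↦ yoneda.obj (F.obj i)) x.1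

/-- The arrow `∐ᵢⱼ y(Uᵢ) ⋆ y(Uⱼ) ⟶ ∐ᵢ y(Uᵢ)` (over pseudo-pullbacks) given by the second
projections. -/
def sndMap : (∐ fun x : F.I × F.I ↦ (F.overlap x).functor) ⟶
    ∐ fun i ↦ yoneda.obj (F.obj i) :=
  Sigma.desc fun x ↦ F.proj₂ x ≫ Sigma.ι (fun i ↦ yoneda.obj (F.obj i)) x.2

/-- The sieve `S({Uᵢ})` of the family `{fᵢ : Uᵢ ⟶ U}`. -/
def sieve : PSh C := coequalizer F.fstMap F.sndMap

/-- The canonical map `S({Uᵢ}) ⟶ y(U)`. -/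
def canonicalMap : F.sieve ⟶ yoneda.obj U :=
  coequalizer.desc (Sigma.desc fun i ↦ yoneda.map (F.map i)) (by
    refine Sigma.hom_ext _ _ fun x ↦ ?_
    simpa [fstMap, sndMap] using F.proj_condition x)

end Family

/-- `K` is orthogonal to `m : A ⟶ A'` if every `f : A ⟶ K` factors uniquely through `m`. -/
def IsOrthogonal {D : Type v} [Category.{w} D] {A A' : D} (m : A ⟶ A') (K : D) : Prop :=
  ∀ f : A ⟶ K, ∃! f' : A' ⟶ K, m ≫ f' = f

/-- The class `M^⊥` of the objects that are orthogonal to all morphisms in `M`. -/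
def orthogonalityClass {D : Type v} [Category.{w} D] (M : MorphismProperty D) :
    ObjectProperty D :=
  fun K ↦ ∀ ⦃A A' : D⦄ (m : A ⟶ A'), M m → IsOrthogonal m K

namespace GrothendieckPrelopology

variable [HasPseudoPullbacks C] (L : GrothendieckPrelopology C)

/-- A presheaf `P` is a sheaf if `Hom(-, P)` sends the canonical map `S({Uᵢ}) ⟶ y(U)` of every
cover to an isomorphism. -/
def isSheaf : ObjectProperty (PSh C) := fun P ↦
  ∀ (U : C) (F : Family U), F ∈ L.covers U → IsIso ((yoneda.obj P).map F.canonicalMap.op)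

/-- The category `Sh(C, L)`. -/
abbrev Sh : Type (u + 1) := L.isSheaf.FullSubcategory

/-- The inclusion of sheaves into presheaves. -/
abbrev inclusion : L.Sh ⥤ PSh C := L.isSheaf.ι

/-- The canonical maps `S({Uᵢ}) ⟶ y(U)` of all covers. -/
def canonicalMaps : MorphismProperty (PSh C) :=
  .ofHoms fun c : Σ U : C, L.covers U ↦ c.2.1.canonicalMap

end GrothendieckPrelopology

end Sheaves

end Prelopology

end

/-!
A presheaf is a sheaf exactly when precomposition with every canonical map `S({Uᵢ}) ⟶ y(U)` is
bijective, i.e. when it is *local* with respect to the class of canonical maps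
(`isSheaf_eq_isLocal`); this is literally orthogonality (`orthogonalityClass_eq_isLocal`). As each
object has a small set of covers, the class of canonical maps is small.

Presheaf categories are locally presentable, so every presheaf is `κ`-presentable for some `κ`.
A small family of presheaves is thus simultaneously `κ`-presentable for all sufficiently large
regular `κ` (`exists_forall_isCardinalPresentable`), which applies to the domains and codomains of
the canonical maps. The orthogonal reflection construction then provides the left adjoint of the
inclusion of sheaves. The sheaves are closed under `κ`-filtered colimits of presheaves, so this
adjunction transfers local `κ`-presentability from presheaves to sheaves.
-/

namespace Prelopology

/-- The members of a small family of objects of a locally presentable category are simultaneously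
`κ`-presentable for all sufficiently large regular cardinals `κ`. -/
lemma exists_forall_isCardinalPresentable {D : Type v} [Category.{w} D]
    [IsLocallyPresentable.{u} D] {T : Type w₁} [Small.{u} T] (X : T → D) :
    ∃ κ₀ : Cardinal.{u}, ∀ (κ : Cardinal.{u}) [Fact κ.IsRegular], κ₀ ≤ κ →
      ∀ t, IsCardinalPresentable (X t) κ := by
  have hX (t : T) : IsPresentable.{u} (X t) := inferInstance
  choose κ hκ h using fun t ↦ (hX t).exists_cardinal
  refine ⟨⨆ t : Shrink.{u} T, κ ((equivShrink T).symm t), fun κ' _ hκ' t ↦ ?_⟩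
  have le : κ t ≤ κ' := by
    refine le_trans ?_ hκ'
    simpa using le_ciSup (f := fun t : Shrink.{u} T ↦ κ ((equivShrink T).symm t))
      Cardinal.bddAbove_of_small (equivShrink T t)
  exact isCardinalPresentable_of_le (X t) le

lemma orthogonalityClass_eq_isLocal {D : Type v} [Category.{w} D] (M : MorphismProperty D) :
    orthogonalityClass M = M.isLocal := by
  ext K
  simp only [orthogonalityClass, IsOrthogonal, MorphismProperty.isLocal_iff,
    Function.bijective_iff_existsUnique]

namespace GrothendieckPrelopology

variable {C : Type u} [SmallCategory C] [SemiCartesianMonoidalCategory C] [HasPseudoPullbacks C]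
  (L : GrothendieckPrelopology C)

lemma isSheaf_eq_isLocal : L.isSheaf = L.canonicalMaps.isLocal := by
  ext P
  refine ⟨fun h ↦ ?_, fun h U F hF ↦ ?_⟩
  · rintro _ _ _ ⟨⟨U, F, hF⟩⟩
    exact (isIso_iff_bijective _).1 (h U F hF)
  · exact (isIso_iff_bijective _).2 (h F.canonicalMap (.mk (⟨U, F, hF⟩ : Σ U : C, L.covers U)))

instance isSmall_canonicalMaps : MorphismProperty.IsSmall.{u} L.canonicalMaps :=
  MorphismProperty.isSmall_ofHoms _

lemma exists_isCardinalPresentable_of_canonicalMaps :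
    ∃ κ₀ : Cardinal.{u}, ∀ (κ : Cardinal.{u}) [Fact κ.IsRegular], κ₀ ≤ κ →
      ∀ ⦃A A' : PSh C⦄ (m : A ⟶ A'), L.canonicalMaps m →
        IsCardinalPresentable A κ ∧ IsCardinalPresentable A' κ := by
  obtain ⟨κ₁, h₁⟩ := exists_forall_isCardinalPresentable.{_, u}
    fun c : Σ U : C, L.covers U ↦ c.2.1.sieve
  obtain ⟨κ₂, h₂⟩ := exists_forall_isCardinalPresentable.{_, u}
    fun c : Σ U : C, L.covers U ↦ yoneda.obj c.1
  refine ⟨max κ₁ κ₂, fun κ _ hκ ↦ ?_⟩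
  rintro _ _ _ ⟨c⟩
  exact ⟨h₁ κ ((le_max_left _ _).trans hκ) c, h₂ κ ((le_max_right _ _).trans hκ) c⟩

lemma isRightAdjoint_inclusion : L.inclusion.IsRightAdjoint := by
  obtain ⟨κ₀, h⟩ := L.exists_isCardinalPresentable_of_canonicalMaps
  -- the successor of an infinite cardinal is regular
  have hκ : Fact (Order.succ (max κ₀ Cardinal.aleph0.{u})).IsRegular :=
    ⟨Cardinal.isRegular_succ (le_max_right _ _)⟩
  have := L.canonicalMaps.isRightAdjoint_ι_isLocal (Order.succ (max κ₀ Cardinal.aleph0))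
    (h _ ((le_max_left κ₀ Cardinal.aleph0).trans (Order.le_succ _)))
  rwa [← L.isSheaf_eq_isLocal] at this

end GrothendieckPrelopology

end Prelopology

theorem mainTheorem2 {C : Type u} [SmallCategory C] [SemiCartesianMonoidalCategory C]
    [Prelopology.HasPseudoPullbacks C] (L : Prelopology.GrothendieckPrelopology C) :
    -- the canonical maps form a set, and the sheaves are the objects orthogonal to them
    MorphismProperty.IsSmall.{u} L.canonicalMaps ∧
    L.isSheaf = Prelopology.orthogonalityClass L.canonicalMaps ∧
    -- sheafification
    (∃ a : Prelopology.PSh C ⥤ L.Sh, Nonempty (a ⊣ L.inclusion) ∧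
      PreservesColimitsOfSize.{w₁, w₂} a) ∧
    -- for all sufficiently large regular cardinals `κ`
    ∃ κ₀ : Cardinal.{u}, ∀ (κ : Cardinal.{u}) [Fact κ.IsRegular], κ₀ ≤ κ →
      -- the canonical maps have `κ`-presentable domains and codomains
      (∀ ⦃A A' : Prelopology.PSh C⦄ (m : A ⟶ A'), L.canonicalMaps m →
        IsCardinalPresentable A κ ∧ IsCardinalPresentable A' κ) ∧
      -- `Sh(C, L)` is locally `κ`-presentable
      IsCardinalLocallyPresentable L.Sh κ ∧
      HasColimits L.Sh ∧
      ∃ G : ObjectProperty L.Sh, ObjectProperty.Small.{u} G ∧ G.IsStrongGenerator ∧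
        ∀ X, G X → IsCardinalPresentable X κ := by
  have := L.isRightAdjoint_inclusion
  obtain ⟨κ₀, h⟩ := L.exists_isCardinalPresentable_of_canonicalMaps
  refine ⟨inferInstance, ?_, ?_, κ₀, fun κ _ hκ ↦ ?_⟩
  · rw [L.isSheaf_eq_isLocal, Prelopology.orthogonalityClass_eq_isLocal]
  · let adj := Adjunction.ofIsRightAdjoint L.inclusion
    exact ⟨_, ⟨adj⟩, adj.leftAdjoint_preservesColimits⟩
  · have hSh : IsCardinalLocallyPresentable L.Sh κ := by
      have := L.canonicalMaps.isLocallyPresentable_isLocal κ (h κ hκ)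
      rwa [← L.isSheaf_eq_isLocal] at this
    obtain ⟨G, hG, hG', hGκ⟩ :=
      (IsCardinalLocallyPresentable.iff_exists_isStrongGenerator L.Sh κ).1 hSh
    exact ⟨h κ hκ, hSh, hSh.toHasColimitsOfSize, G, hG, hG', hGκ⟩
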